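/- \textbf{Setting.} One indivisible object, $n\ge 2$ bidders, $\bar v>0$, and $m\in(0,\bar v)^n$. Let $\Delta(m,\bar v)$ be the set of Borel probability distributions $F$ on $[0,\bar v]^n$ with $\int v_i\,dF=m_i$ for all $i$. A (direct, deterministic) mechanism $M=(x,t)$ consists of measurable functions $x_i:[0,\bar v]^n\to\{0,1\}$ with $\sum_i x_i\le 1$ and measurable transfers $t_i:[0,\bar v]^n\to\mathbb R$; its revenue guarantee is $\underline R(M)=\inf_{F\in\Delta(m,\bar v)}\int\sum_i t_i(v)\,dF$. For $r\in[0,\bar v]^n$, a corner-hitting linear score auction with generalized reserve prices $r$ is a dominant-strategy incentive compatible, ex post individually rational mechanism such that, with the scores $s_i(v_i)=\frac{v_i-r_i}{\bar v-r_i}$ if $r_i<\bar v$ and $s_i(v_i)=v_i-\bar v$ if $r_i=\bar v$, one has $x_i(v)=1$ whenever $s_i(v_i)>\max\{\max_{j\ne i}s_j(v_j),0\}$ and $x_i(v)=0$ whenever $s_i(v_i)<\max\{\max_{j\ne i}s_j(v_j),0\}$. Call $r\in[0,\bar v]^n$ \emph{optimal} if some corner-hitting linear score auction with generalized reserve prices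 $r$ maximizes $\underline R$ among all corner-hitting linear score auctions (with arbitrary generalized reserve prices in $[0,\bar v]^n$). \textbf{Strictly included bidders.} Enumerate the bidders so that $m_1\le\dots\le m_n$, let $$k^*=\min\Big\{k\in\{1,\dots,n-1\}:\ \sum_{i=k+1}^n\frac{\sqrt{\bar v-m_i}}{\sqrt{\bar v-m_k}}>n-k-1\Big\},$$ let $\lambda_i^*=0$ for $i<k^*$ and $\lambda^*_i=\frac{1}{\sqrt{\bar v-m_i}}\cdot\frac{\sum_{j=k^*}^n\sqrt{\bar v-m_j}}{n-k^*}-1$ for $i\ge k^*$, and put $SI=\{i:\lambda_i^*>0\}$. \textbf{Proposition (optimal prices).} \begin{enumerate} \item If $\sum_{i=1}^n\sqrt{1-m_i/\bar v}>n-1$ (low means), there is a unique optimal vector $r^*$, given by $r_i^*=\bar v-\sqrt{\bar v(\bar v-m_i)}$ for all $i$. \item If $\sum_{i=1}^n\sqrt{1-m_i/\bar v}\le n-1$ (high means), a vector $r\in[0,\bar v]^n$ is optimal if and only if $$\sum_{i\in SI}r_i\le\bar v,\qquad r_i<\bar v\ \text{ for all } i\in SI,\qquad\frac{\bar v-r_i}{\bar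 v-r_j}=\sqrt{\frac{\bar v-m_i}{\bar v-m_j}}\ \text{ for all } i,j\in SI.$$ In particular the reserve prices $r_i\in[0,\bar v]$ of the bidders $i\notin SI$ (the weakly excluded ones) are arbitrary. \end{enumerate} -/

import Mathlib

open MeasureTheory

noncomputable section

namespace RobustAuction

/-- The set `V = [0, vbar]^n` of value profiles of the `n` bidders. -/
abbrev Profile (n : ℕ) (vbar : ℝ) : Type := Fin n → Set.Icc (0 : ℝ) vbar

/-- Direct deterministic mechanisms: `x v i` is the allocation to bidder `i` and `t v i` is the
transfer paid by bidder `i` when the reported profile of values is `v`. -/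
structure Mechanism (n : ℕ) (vbar : ℝ) where
  x : Profile n vbar → Fin n → ℝ
  t : Profile n vbar → Fin n → ℝ
  measurable_x : ∀ i, Measurable fun v => x v i
  measurable_t : ∀ i, Measurable fun v => t v i
  deterministic : ∀ v i, x v i = 0 ∨ x v i = 1
  supply : ∀ v, ∑ i, x v i ≤ 1

variable {n : ℕ} {vbar : ℝ}

/-- Dominant-strategy incentive compatibility: whatever the others report, bidder `i` with true
value `v i` does not gain by reporting another value `w`. -/
def Mechanism.IsDSIC (M : Mechanism n vbar) : Prop :=
  ∀ (v : Profile n vbar) (i : Fin n) (w : Set.Icc (0 : ℝ) vbar),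
    (v i : ℝ) * M.x (Function.update v i w) i - M.t (Function.update v i w) i
      ≤ (v i : ℝ) * M.x v i - M.t v i

/-- Ex post individual rationality. -/
def Mechanism.IsEPIR (M : Mechanism n vbar) : Prop :=
  ∀ (v : Profile n vbar) (i : Fin n), 0 ≤ (v i : ℝ) * M.x v i - M.t v i

/-- The set `Δ(m, vbar)` of Borel distributions on `[0, vbar]^n` with vector of means `m`. -/
def feasibleDistributions (m : Fin n → ℝ) (vbar : ℝ) : Set (Measure (Profile n vbar)) :=
  {F | IsProbabilityMeasure F ∧ ∀ i, ∫ v, (v i : ℝ) ∂F = m i}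

/-- The seller's expected revenue `R(M, F)`, the integral of `∑ i, t i` against `F`, written as the
integral of the positive part minus that of the negative part. For an ex post individually rational
mechanism the revenue is at most `n * vbar` pointwise, so that the first integral is finite and the
expectation is well defined in `[-∞, ∞)`. -/
def Mechanism.revenue (M : Mechanism n vbar) (F : Measure (Profile n vbar)) : EReal :=
  ((∫⁻ v, ENNReal.ofReal (∑ i, M.t v i) ∂F : ENNReal) : EReal)
    - ((∫⁻ v, ENNReal.ofReal (-∑ i, M.t v i) ∂F : ENNReal) : EReal)

/-- The revenue guarantee of a mechanism: the infimum of its expected revenue over all feasible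
distributions. -/
def Mechanism.guarantee (M : Mechanism n vbar) (m : Fin n → ℝ) : EReal :=
  ⨅ F ∈ feasibleDistributions m vbar, M.revenue F

/-- The linear score `β i * v i - α i` of bidder `i`. -/
def score (α β : Fin n → ℝ) (v : Profile n vbar) (i : Fin n) : ℝ := β i * (v i : ℝ) - α i

/-- `M` is a linear score auction with parameters `α i ≥ 0`, `β i > 0`: it is dominant-strategy
incentive compatible and ex post individually rational, bidder `i` wins if
`s_i > max (max_{j ≠ i} s_j) 0` and does not win if `s_i < max (max_{j ≠ i} s_j) 0`. -/
structure IsLinearScoreAuction (α β : Fin n → ℝ) (M : Mechanism n vbar) : Prop where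
  alpha_nonneg : ∀ i, 0 ≤ α i
  beta_pos : ∀ i, 0 < β i
  dsic : M.IsDSIC
  epir : M.IsEPIR
  wins : ∀ v i, 0 < score α β v i → (∀ j, j ≠ i → score α β v j < score α β v i) → M.x v i = 1
  loses : ∀ v i, (score α β v i < 0 ∨ ∃ j, j ≠ i ∧ score α β v i < score α β v j) → M.x v i = 0

/-- The intercept `α i` of the score in the corner-hitting linear score auction with generalized
reserve prices `r`. -/
def cornerAlpha (vbar : ℝ) (r : Fin n → ℝ) (i : Fin n) : ℝ :=
  if r i < vbar then r i / (vbar - r i) else r i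

/-- The slope `β i` of the score in the corner-hitting linear score auction with generalized
reserve prices `r`. -/
def cornerBeta (vbar : ℝ) (r : Fin n → ℝ) (i : Fin n) : ℝ :=
  if r i < vbar then 1 / (vbar - r i) else 1

/-- `M` is a corner-hitting linear score auction with generalized reserve prices
`r ∈ [0, vbar]^n`. -/
def IsCornerHittingLSA (r : Fin n → ℝ) (M : Mechanism n vbar) : Prop :=
  (∀ i, r i ∈ Set.Icc 0 vbar) ∧ IsLinearScoreAuction (cornerAlpha vbar r) (cornerBeta vbar r) M

/-- `r` is an optimal vector of generalized reserve prices: some corner-hitting linear score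
auction with reserve prices `r` maximizes the revenue guarantee among all corner-hitting linear
score auctions (with any reserve prices). -/
def IsOptimalPrices (vbar : ℝ) (m r : Fin n → ℝ) : Prop :=
  ∃ M : Mechanism n vbar, IsCornerHittingLSA r M ∧
    ∀ (r' : Fin n → ℝ) (M' : Mechanism n vbar),
      IsCornerHittingLSA r' M' → M'.guarantee m ≤ M.guarantee m

/-- For means `μ` listed in nondecreasing order, the number
`k* = min {k ≤ n - 1 | ∑_{i = k + 1}^n √(vbar - μ_i) / √(vbar - μ_k) > n - k - 1}`.
Bidders are numbered from `1` in this formula, so that position `k` is the element `k - 1` of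
`Fin n`. -/
def kStar (vbar : ℝ) (μ : Fin n → ℝ) : ℕ :=
  sInf {k : ℕ | k + 1 ≤ n ∧ ∃ a : Fin n, (a : ℕ) + 1 = k ∧
    (n : ℝ) - k - 1 < ∑ i ∈ Finset.Ioi a, √(vbar - μ i) / √(vbar - μ a)}

/-- For means `μ` listed in nondecreasing order, the optimal Lagrange multipliers in the case of
high means: zero at the positions `i < k*`, and
`(∑_{j = k*}^n √(vbar - μ_j) / (n - k*)) / √(vbar - μ_i) - 1` at the positions `i ≥ k*`
(positions numbered from `1`). -/
def lambdaHigh (vbar : ℝ) (μ : Fin n → ℝ) (i : Fin n) : ℝ :=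
  if (i : ℕ) + 1 < kStar vbar μ then 0
  else (∑ j ∈ Finset.univ.filter (fun j : Fin n => kStar vbar μ ≤ (j : ℕ) + 1), √(vbar - μ j))
      / ((n : ℝ) - kStar vbar μ) / √(vbar - μ i) - 1

/-- The set `SI(m, vbar)` of strictly included bidders in the case of high means, when `σ`
enumerates the bidders in nondecreasing order of their means (so that bidder `i` stands at
position `σ⁻¹ i`): those whose optimal Lagrange multiplier is positive. -/
def strictlyIncluded (vbar : ℝ) (m : Fin n → ℝ) (σ : Equiv.Perm (Fin n)) : Finset (Fin n) :=
  Finset.univ.filter fun i => 0 < lambdaHigh vbar (m ∘ σ) (σ.symm i)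

end RobustAuction

end

/-!
Write `b = vbar`, `a i = b - r i` and `μ i = b - m i`. The revenue guarantee of an auction at the
vector of means `m` is the value at `m` of the lower convex envelope of its revenue, hence the
largest value at `m` of an affine function `c - ∑ i, lam i * (b - v i)` lying below the revenue.
For a corner-hitting linear score auction that charges threshold prices, such a function with
`lam ≥ 0` lies below the revenue exactly if it does so at the corner, near `r`, and at the points
where a single bidder has value `b` and the others are near their reserve prices: `IsDualFeasible`
lists these inequalities.

That every lower bound for the guarantee comes from a dual feasible function is
`IsCornerHittingLSA.exists_isDualFeasible`; it uses a supporting hyperplane of the convex set of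
attainable pairs of means and revenues (`Mechanism.exists_affine_le`), which exists since `m` is an
interior point. Conversely `scoreAuction`, which charges threshold prices, guarantees every dual
feasible value (`IsDualFeasible.le_guarantee`).

Choosing prices optimally therefore means maximizing `c - ∑ i, lam i * μ i` jointly over prices and
dual feasible functions. For given `lam` the largest intercept over all prices is
`b * min 1 (load lam)` with `load lam = ∑ i, lam i / (1 + lam i)`, so that a concave problem in `lam`
remains. Its optimality conditions (`IsCritical`) determine `lam` uniquely
(`IsDualFeasible.eq_of_value_ge`), and the optimal prices are those for which this `lam` is dual
feasible with intercept `b * load lam` (`isOptimalPrices_iff`). Complementary slackness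
(`IsDualFeasible.complementary`) then gives `a i * (1 + lam i)` the same value for all bidders with
`lam i > 0`. For low means the load is below `1`, all `lam i` are positive and the common value is
`b`. For high means the load is `1`, the solution is `lambdaHigh`, and the common value may be any
number that is at least `b`; this is the condition that the reserve prices of the strictly included
bidders sum to at most `b`.
-/

namespace RobustAuction

/-! ### The dual program -/

section Dual

variable {ι : Type*} [Fintype ι] {b c η : ℝ} {a μ lam x : ι → ℝ}

/-- The affine function `v ↦ c - ∑ i, lam i * (b - v i)`, with `lam ≥ 0`, lies below the revenue of
the corner-hitting linear score auction with reserve prices `r i = b - a i` that charges threshold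
prices. Up to monotonicity and convexity it suffices to compare them at the corner `(b, …, b)`,
where the revenue is `b`, at `r`, where it is `0`, and at the points obtained from `r` by raising one
coordinate `i` to `b`, where it is `r i`; the three inequalities say exactly this. A bidder `i` with
`a i = 0` never wins, but the bound at `r` makes the third inequality hold for it anyway. -/
structure IsDualFeasible (b : ℝ) (a lam : ι → ℝ) (c : ℝ) : Prop where
  nonneg : ∀ i, 0 ≤ lam i
  le_corner : c ≤ b
  le_reserve : c ≤ ∑ j, lam j * a j
  le_single : ∀ i, a i * (1 + lam i) ≤ b + ∑ j, lam j * a j - c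

/-- The quantity `∑ i, lam i / (1 + lam i)`. With the best reserve prices for `lam`, the largest
feasible intercept is `b * min 1 (load lam)`. -/
noncomputable def load (lam : ι → ℝ) : ℝ := ∑ i, lam i / (1 + lam i)

theorem IsDualFeasible.load_gap (h : IsDualFeasible b a lam c) :
    (b + ∑ j, lam j * a j - c) * load lam - ∑ j, lam j * a j =
      ∑ i, lam i / (1 + lam i) * (b + ∑ j, lam j * a j - c - a i * (1 + lam i)) := by
  rw [load, Finset.mul_sum, ← Finset.sum_sub_distrib]
  refine Finset.sum_congr rfl fun i _ => ?_
  have := h.nonneg i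
  field_simp

theorem IsDualFeasible.load_gap_terms_nonneg (h : IsDualFeasible b a lam c) (i : ι) :
    0 ≤ lam i / (1 + lam i) * (b + ∑ j, lam j * a j - c - a i * (1 + lam i)) := by
  have := h.nonneg i
  have := h.le_single i
  exact mul_nonneg (by positivity) (by linarith)

theorem IsDualFeasible.le_mul_load (h : IsDualFeasible b a lam c) (hb : 0 ≤ b) :
    c ≤ b * load lam := by
  have h1 := h.load_gap ▸ Finset.sum_nonneg fun i _ => h.load_gap_terms_nonneg i
  have h2 := h.le_reserve
  have h3 := h.le_corner
  rcases le_total 1 (load lam) with hl | hl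
  · nlinarith
  · nlinarith

/-- The optimality conditions for maximizing `b * min 1 (load lam) - ∑ i, lam i * μ i` over
`lam ≥ 0`; here `η` is `b` times the supergradient of `min 1` at `load lam`. -/
structure IsCritical (b η : ℝ) (μ lam : ι → ℝ) : Prop where
  nonneg : ∀ i, 0 ≤ lam i
  eta_nonneg : 0 ≤ η
  eta_le : η ≤ b
  le_sq : ∀ i, η ≤ (1 + lam i) ^ 2 * μ i
  eq_or : ∀ i, lam i = 0 ∨ η = (1 + lam i) ^ 2 * μ i
  load_le : load lam ≤ 1
  slack : (b - η) * (1 - load lam) = 0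

/-- Strict concavity of `x ↦ η x / (1 + x) - x p`, in the form of a quadratic gap at its maximizer
`y` on `[0, ∞)`. -/
theorem coordinate_gap {x y p : ℝ} (hx : 0 ≤ x) (hy : 0 ≤ y) (hle : η ≤ (1 + y) ^ 2 * p)
    (heq : y = 0 ∨ η = (1 + y) ^ 2 * p) :
    η * (x / (1 + x)) - x * p ≤ η * (y / (1 + y)) - y * p - p * (x - y) ^ 2 / (1 + x) := by
  have key : η * (x / (1 + x)) - x * p - (η * (y / (1 + y)) - y * p - p * (x - y) ^ 2 / (1 + x))
      = (x - y) * (η - (1 + y) ^ 2 * p) / ((1 + x) * (1 + y)) := by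
    field_simp
    ring
  have : (x - y) * (η - (1 + y) ^ 2 * p) / ((1 + x) * (1 + y)) ≤ 0 := by
    apply div_nonpos_of_nonpos_of_nonneg _ (by positivity)
    rcases heq with h | h
    · subst h; nlinarith
    · rw [← h]; simp
  linarith

theorem IsDualFeasible.value_add_gap_le (h : IsDualFeasible b a x c) (hb : 0 < b)
    (hc : IsCritical b η μ lam) :
    c - ∑ i, x i * μ i + ∑ i, μ i * (x i - lam i) ^ 2 / (1 + x i)
      ≤ b * load lam - ∑ i, lam i * μ i := by
  have h1 : ∑ i, (η * (x i / (1 + x i)) - x i * μ i) ≤ ∑ i, (η * (lam i / (1 + lam i))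
      - lam i * μ i - μ i * (x i - lam i) ^ 2 / (1 + x i)) :=
    Finset.sum_le_sum fun i _ =>
      coordinate_gap (h.nonneg i) (hc.nonneg i) (hc.le_sq i) (hc.eq_or i)
  simp only [Finset.sum_sub_distrib, ← Finset.mul_sum] at h1
  change η * load x - _ ≤ η * load lam - _ - _ at h1
  have h2 : c ≤ (b - η) + η * load x := by
    have h3 := h.le_corner
    have h4 := h.le_mul_load hb.le
    have h5 := hc.eta_nonneg
    have h6 := hc.eta_le
    have : b * c ≤ b * ((b - η) + η * load x) := by nlinarith
    exact le_of_mul_le_mul_left this hb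
  have := hc.slack
  linarith

theorem IsDualFeasible.value_le (h : IsDualFeasible b a x c) (hb : 0 < b) (hμ : ∀ i, 0 < μ i)
    (hc : IsCritical b η μ lam) : c - ∑ i, x i * μ i ≤ b * load lam - ∑ i, lam i * μ i := by
  have h1 := h.value_add_gap_le hb hc
  have h2 : 0 ≤ ∑ i, μ i * (x i - lam i) ^ 2 / (1 + x i) := Finset.sum_nonneg fun i _ => by
    have := h.nonneg i
    have := hμ i
    positivity
  linarith

theorem IsDualFeasible.eq_of_value_ge (h : IsDualFeasible b a x c) (hb : 0 < b)
    (hμ : ∀ i, 0 < μ i) (hc : IsCritical b η μ lam)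
    (hv : b * load lam - ∑ i, lam i * μ i ≤ c - ∑ i, x i * μ i) :
    x = lam ∧ c = b * load lam := by
  have h1 := h.value_add_gap_le hb hc
  have h2 : ∀ i ∈ Finset.univ, 0 ≤ μ i * (x i - lam i) ^ 2 / (1 + x i) := fun i _ => by
    have := h.nonneg i
    have := hμ i
    positivity
  have h3 := (Finset.sum_eq_zero_iff_of_nonneg h2).1
    (le_antisymm (by linarith) (Finset.sum_nonneg h2))
  have hx : x = lam := by
    funext i
    have h4 := h3 i (Finset.mem_univ i)
    have h5 := h.nonneg i
    have h6 := hμ i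
    have h7 : (1 + x i) ≠ 0 := by positivity
    rw [div_eq_zero_iff, or_iff_left h7, mul_eq_zero, or_iff_right h6.ne'] at h4
    have := pow_eq_zero_iff (two_ne_zero) |>.1 h4
    linarith
  refine ⟨hx, le_antisymm (hx ▸ h.le_mul_load hb.le) ?_⟩
  rw [hx] at hv
  linarith

/-- If the intercept is as large as the load of the multipliers permits, then complementary
slackness determines the reserve prices of the bidders with positive multipliers up to a common
factor, and this factor is pinned down when the load is below `1`. -/
theorem IsDualFeasible.complementary (h : IsDualFeasible b a lam c) (hl : load lam ≤ 1)
    (hc : c = b * load lam) :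
    (1 - load lam) * (∑ j, lam j * a j - c) = 0 ∧
      ∀ i, 0 < lam i → a i * (1 + lam i) = b + ∑ j, lam j * a j - c := by
  have h1 := h.load_gap
  have h2 : ∀ i ∈ Finset.univ, 0 ≤ lam i / (1 + lam i) *
    (b + ∑ j, lam j * a j - c - a i * (1 + lam i)) := fun i _ => h.load_gap_terms_nonneg i
  have h3 := Finset.sum_nonneg h2
  have h4 : 0 ≤ (1 - load lam) * (∑ j, lam j * a j - c) :=
    mul_nonneg (by linarith) (by linarith [h.le_reserve])
  have h5 : (b + ∑ j, lam j * a j - c) * load lam - ∑ j, lam j * a j =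
      -((1 - load lam) * (∑ j, lam j * a j - c)) := by
    rw [hc]; ring
  refine ⟨by linarith, fun i hi => ?_⟩
  have h6 := (Finset.sum_eq_zero_iff_of_nonneg h2).1 (by linarith) i (Finset.mem_univ i)
  rw [mul_eq_zero, or_iff_right (by positivity)] at h6
  linarith

/-- With `a i = b / (1 + lam i)` the three bounds on the intercept are attained together. -/
theorem isDualFeasible_div (hb : 0 ≤ b) (hlam : ∀ i, 0 ≤ lam i) (hl : load lam ≤ 1) :
    IsDualFeasible b (fun i => b / (1 + lam i)) lam (b * load lam) := by
  have hS : ∑ j, lam j * (b / (1 + lam j)) = b * load lam := by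
    rw [load, Finset.mul_sum]
    exact Finset.sum_congr rfl fun i _ => by ring
  refine ⟨hlam, by nlinarith, hS.ge, fun i => ?_⟩
  have := hlam i
  rw [hS]
  field_simp
  linarith

end Dual

/-! ### Upper bounds for the guarantee -/

section

variable {n : ℕ} {vbar : ℝ}

theorem integrable_coord (F : Measure (Profile n vbar)) [IsFiniteMeasure F] (i : Fin n) :
    Integrable (fun v : Profile n vbar => (v i : ℝ)) F := by
  refine Integrable.of_bound (C := |vbar|)
    (measurable_subtype_coe.comp (measurable_pi_apply i)).aestronglyMeasurable
    (Filter.Eventually.of_forall fun v => ?_)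
  rw [Real.norm_eq_abs, abs_of_nonneg (v i).2.1]
  exact (v i).2.2.trans (le_abs_self _)

theorem Mechanism.measurable_sum_t (M : Mechanism n vbar) :
    Measurable fun v => ∑ i, M.t v i :=
  Finset.measurable_sum _ fun i _ => M.measurable_t i

theorem Mechanism.revenue_eq_integral (M : Mechanism n vbar) {F : Measure (Profile n vbar)}
    (h : Integrable (fun v => ∑ i, M.t v i) F) :
    M.revenue F = ((∫ v, ∑ i, M.t v i ∂F : ℝ) : EReal) := by
  have h1 : (∫⁻ v, ENNReal.ofReal (∑ i, M.t v i) ∂F) ≠ ⊤ :=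
    h.lintegral_lt_top.ne
  have h2 : (∫⁻ v, ENNReal.ofReal (-∑ i, M.t v i) ∂F) ≠ ⊤ :=
    h.neg.lintegral_lt_top.ne
  rw [integral_eq_lintegral_pos_part_sub_lintegral_neg_part h, Mechanism.revenue, EReal.coe_sub,
    EReal.coe_ennreal_toReal h1, EReal.coe_ennreal_toReal h2]

/-- The pairs of a vector of means and a number above the expected revenue of `M` for some
distribution with these means: the epigraph of the lower convex envelope of the revenue. -/
def Mechanism.envelopeEpigraph (M : Mechanism n vbar) : Set ((Fin n → ℝ) × ℝ) :=
  {p | ∃ F : Measure (Profile n vbar), IsProbabilityMeasure F ∧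
    (∀ i, ∫ v, (v i : ℝ) ∂F = p.1 i) ∧ Integrable (fun v => ∑ i, M.t v i) F ∧
    ∫ v, ∑ i, M.t v i ∂F ≤ p.2}

theorem Mechanism.convex_envelopeEpigraph (M : Mechanism n vbar) :
    Convex ℝ M.envelopeEpigraph := by
  rintro p ⟨F, hF, hFm, hFi, hFr⟩ q ⟨G, hG, hGm, hGi, hGr⟩ s t hs ht hst
  have hint : ∀ f : Profile n vbar → ℝ, Integrable f F → Integrable f G →
      Integrable f (ENNReal.ofReal s • F + ENNReal.ofReal t • G) ∧
      ∫ v, f v ∂(ENNReal.ofReal s • F + ENNReal.ofReal t • G)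
        = s * ∫ v, f v ∂F + t * ∫ v, f v ∂G := by
    intro f hf hg
    have hf' := hf.smul_measure (c := ENNReal.ofReal s) ENNReal.ofReal_ne_top
    have hg' := hg.smul_measure (c := ENNReal.ofReal t) ENNReal.ofReal_ne_top
    refine ⟨hf'.add_measure hg', ?_⟩
    rw [integral_add_measure hf' hg', integral_smul_measure, integral_smul_measure,
      ENNReal.toReal_ofReal hs, ENNReal.toReal_ofReal ht, smul_eq_mul, smul_eq_mul]
  refine ⟨ENNReal.ofReal s • F + ENNReal.ofReal t • G, ⟨?_⟩, fun i => ?_,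
    (hint _ hFi hGi).1, ?_⟩
  · simp [← ENNReal.ofReal_add hs ht, hst]
  · rw [(hint _ (integrable_coord F i) (integrable_coord G i)).2, hFm, hGm]
    simp
  · rw [(hint _ hFi hGi).2]
    simp only [Prod.snd_add, Prod.smul_snd, smul_eq_mul]
    gcongr

theorem Mechanism.mem_envelopeEpigraph (M : Mechanism n vbar) (v : Profile n vbar) {y : ℝ}
    (hy : ∑ i, M.t v i ≤ y) : ((fun i => (v i : ℝ)), y) ∈ M.envelopeEpigraph := by
  refine ⟨Measure.dirac v, inferInstance, fun i => ?_, ?_, ?_⟩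
  · rw [integral_dirac]
  · exact integrable_dirac (by simp)
  · rwa [integral_dirac]

theorem Mechanism.notMem_interior_envelopeEpigraph (M : Mechanism n vbar) {m : Fin n → ℝ} {g : ℝ}
    (hg : (g : EReal) ≤ M.guarantee m) : (m, g) ∉ interior M.envelopeEpigraph := by
  intro hmem
  -- Otherwise some distribution with means `m` would yield less than `g`.
  have hcont : Filter.Tendsto (fun e : ℝ => (m, g - e)) (nhdsWithin 0 (Set.Ioi 0))
      (nhds (m, g)) := by
    have : Continuous fun e : ℝ => (m, g - e) := by fun_prop
    simpa using (this.tendsto 0).mono_left nhdsWithin_le_nhds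
  obtain ⟨e, ⟨F, hF, hFm, hFi, hFr⟩, he⟩ :=
    ((hcont.eventually (mem_interior_iff_mem_nhds.1 hmem)).and self_mem_nhdsWithin).exists
  have h1 : (g : EReal) ≤ M.revenue F := hg.trans (iInf₂_le F ⟨hF, hFm⟩)
  rw [M.revenue_eq_integral hFi, EReal.coe_le_coe_iff] at h1
  have : (0 : ℝ) < e := he
  dsimp only at hFr
  linarith

/-- A supporting hyperplane of the lower convex envelope of the revenue at the interior point `m`:
some affine function with value `g` at `m` lies below the revenue everywhere. -/
theorem Mechanism.exists_affine_le (M : Mechanism n vbar) {m : Fin n → ℝ} {g : ℝ}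
    (hm : ∀ i, m i ∈ Set.Ioo 0 vbar) (hle : ∀ v, ∑ i, M.t v i ≤ vbar)
    (hg : (g : EReal) ≤ M.guarantee m) :
    ∃ lam : Fin n → ℝ, ∀ v : Profile n vbar,
      g + ∑ i, lam i * ((v i : ℝ) - m i) ≤ ∑ i, M.t v i := by
  have hopen : ∀ u : Fin n → ℝ, ∀ y : ℝ, (∀ i, u i ∈ Set.Ioo 0 vbar) → vbar < y →
      (u, y) ∈ interior M.envelopeEpigraph := by
    intro u y hu hy
    refine mem_interior.2 ⟨Set.pi Set.univ (fun _ => Set.Ioo 0 vbar) ×ˢ Set.Ioi vbar, ?_,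
      (isOpen_set_pi Set.finite_univ fun _ _ => isOpen_Ioo).prod isOpen_Ioi,
      ⟨fun i _ => hu i, hy⟩⟩
    rintro ⟨u, y⟩ ⟨hu, hy⟩
    exact M.mem_envelopeEpigraph (fun i => ⟨u i, Set.Ioo_subset_Icc_self (hu i trivial)⟩)
      ((hle _).trans (le_of_lt hy))
  have hmem := hopen m (max vbar g + 1) hm (by linarith [le_max_left vbar g])
  have hconv := M.convex_envelopeEpigraph
  obtain ⟨f, hf⟩ := geometric_hahn_banach_open_point hconv.interior isOpen_interior
    (M.notMem_interior_envelopeEpigraph hg)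
  have hf' : ∀ p ∈ M.envelopeEpigraph, f p ≤ f (m, g) := by
    intro p hp
    have hcl : p ∈ closure (interior M.envelopeEpigraph) := by
      rw [hconv.closure_interior_eq_closure_of_nonempty_interior ⟨_, hmem⟩]
      exact subset_closure hp
    exact closure_minimal (t := {p | f p ≤ f (m, g)}) (fun q hq => (hf q hq).le)
      (isClosed_le f.continuous continuous_const) hcl
  have hdec : ∀ (u : Fin n → ℝ) (y : ℝ),
      f (u, y) = ∑ i, u i * f (Pi.single i 1, 0) + y * f (0, 1) := by
    intro u y
    have h1 : (u, y) = ∑ i, u i • ((Pi.single i 1, 0) : (Fin n → ℝ) × ℝ) + y • (0, 1) := by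
      ext j
      · simp [Prod.fst_sum, Finset.sum_apply, Pi.single_apply]
      · simp [Prod.snd_sum]
    conv_lhs => rw [h1]
    simp only [map_add, map_sum, map_smul, smul_eq_mul]
  -- Points vertically above `m` show that the functional is not vertical.
  have hk : f (0, 1) < 0 := by
    have h1 := hf _ hmem
    rw [hdec, hdec m g] at h1
    have : g < max vbar g + 1 := by linarith [le_max_right vbar g]
    nlinarith
  refine ⟨fun i => f (Pi.single i 1, 0) / -f (0, 1), fun v => ?_⟩
  have h1 := hf' _ (M.mem_envelopeEpigraph v le_rfl)
  rw [hdec, hdec m g] at h1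
  have h2 : ∑ i, f (Pi.single i 1, 0) / -f (0, 1) * ((v i : ℝ) - m i) =
      (∑ i, (v i : ℝ) * f (Pi.single i 1, 0) - ∑ i, m i * f (Pi.single i 1, 0)) / -f (0, 1) := by
    rw [← Finset.sum_sub_distrib, Finset.sum_div]
    exact Finset.sum_congr rfl fun i _ => by ring
  rw [h2, ← le_sub_iff_add_le', div_le_iff₀ (by linarith)]
  linarith

/-- A negative coefficient can be replaced by `0` at the price of testing the inequality only at
profiles where the corresponding value is `0`. -/
theorem Mechanism.exists_nonneg_affine_le (M : Mechanism n vbar) {m : Fin n → ℝ} {g : ℝ}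
    (hm : ∀ i, m i ∈ Set.Ioo 0 vbar) (hle : ∀ v, ∑ i, M.t v i ≤ vbar)
    (hg : (g : EReal) ≤ M.guarantee m) :
    ∃ lam : Fin n → ℝ, (∀ i, 0 ≤ lam i) ∧ ∀ v : Profile n vbar,
      (∀ i, lam i = 0 → (v i : ℝ) = 0) → g + ∑ i, lam i * ((v i : ℝ) - m i) ≤ ∑ i, M.t v i := by
  obtain ⟨lam, h⟩ := M.exists_affine_le hm hle hg
  refine ⟨fun i => max (lam i) 0, fun i => le_max_right _ _, fun v hv => le_trans ?_ (h v)⟩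
  refine add_le_add_right (Finset.sum_le_sum fun i _ => ?_) g
  have := (hm i).1
  dsimp only
  rcases le_total (lam i) 0 with hi | hi
  · rw [hv i (max_eq_right hi), max_eq_right hi]
    nlinarith
  · rw [max_eq_left hi]

section CornerHitting

variable {r : Fin n → ℝ} {M : Mechanism n vbar} {v : Profile n vbar} {i : Fin n}

/-- The score `s_i(v_i)` of the corner-hitting auction with reserve prices `r`. -/
noncomputable def cornerScore (r : Fin n → ℝ) (v : Profile n vbar) (i : Fin n) : ℝ :=
  score (cornerAlpha vbar r) (cornerBeta vbar r) v i

theorem cornerScore_of_lt (h : r i < vbar) :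
    cornerScore r v i = ((v i : ℝ) - r i) / (vbar - r i) := by
  simp only [cornerScore, score, cornerAlpha, cornerBeta, if_pos h]
  ring

theorem cornerScore_of_eq (h : r i = vbar) : cornerScore r v i = (v i : ℝ) - vbar := by
  simp [cornerScore, score, cornerAlpha, cornerBeta, h]

theorem cornerScore_nonpos (hr : r i ≤ vbar) (h : (v i : ℝ) ≤ r i) : cornerScore r v i ≤ 0 := by
  rcases hr.lt_or_eq with h1 | h1
  · rw [cornerScore_of_lt h1]
    exact div_nonpos_of_nonpos_of_nonneg (by linarith) (by linarith)
  · rw [cornerScore_of_eq h1]; linarith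

theorem cornerScore_neg (hr : r i ≤ vbar) (h : (v i : ℝ) < r i) : cornerScore r v i < 0 := by
  rcases hr.lt_or_eq with h1 | h1
  · rw [cornerScore_of_lt h1]
    exact div_neg_of_neg_of_pos (by linarith) (by linarith)
  · rw [cornerScore_of_eq h1]; linarith

theorem cornerScore_pos (hr : r i < vbar) (h : r i < (v i : ℝ)) : 0 < cornerScore r v i := by
  rw [cornerScore_of_lt hr]
  exact div_pos (by linarith) (by linarith)

theorem Mechanism.x_nonneg (M : Mechanism n vbar) (v : Profile n vbar) (i : Fin n) :
    0 ≤ M.x v i := by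
  rcases M.deterministic v i with h | h <;> simp [h]

theorem Mechanism.IsEPIR.t_le (h : M.IsEPIR) (v : Profile n vbar) (i : Fin n) :
    M.t v i ≤ (v i : ℝ) * M.x v i := sub_nonneg.1 (h v i)

theorem Mechanism.IsEPIR.sum_t_le (h : M.IsEPIR) (hb : 0 ≤ vbar) (v : Profile n vbar) :
    ∑ i, M.t v i ≤ vbar :=
  calc ∑ i, M.t v i ≤ ∑ i, vbar * M.x v i := Finset.sum_le_sum fun i _ =>
        (h.t_le v i).trans (mul_le_mul_of_nonneg_right (v i).2.2 (M.x_nonneg v i))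
    _ = vbar * ∑ i, M.x v i := by rw [Finset.mul_sum]
    _ ≤ vbar := by nlinarith [M.supply v]

theorem IsCornerHittingLSA.t_nonpos (h : IsCornerHittingLSA r M)
    (hv : (v i : ℝ) = 0 ∨ (v i : ℝ) < r i) : M.t v i ≤ 0 := by
  refine (h.2.epir.t_le v i).trans ?_
  rcases hv with hv | hv
  · simp [hv]
  · rw [h.2.loses v i (Or.inl (cornerScore_neg (h.1 i).2 hv)), mul_zero]

theorem IsCornerHittingLSA.sum_t_le_reserve (h : IsCornerHittingLSA r M) (hi : r i < vbar)
    (hvi : (v i : ℝ) = vbar) (hv : ∀ j, j ≠ i → (v j : ℝ) = 0 ∨ (v j : ℝ) < r j) :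
    ∑ j, M.t v j ≤ r i := by
  have h1 : ∑ j ∈ Finset.univ.erase i, M.t v j ≤ 0 :=
    Finset.sum_nonpos fun j hj => h.t_nonpos (hv j (Finset.ne_of_mem_erase hj))
  rw [← Finset.add_sum_erase _ _ (Finset.mem_univ i)]
  suffices M.t v i ≤ r i by linarith
  -- Every value above `r i` wins as well and pays at most itself, so that incentive compatibility
  -- bounds the price at the value `vbar`.
  refine le_of_forall_gt_imp_ge_of_dense fun w hw => ?_
  rcases le_total vbar w with hwb | hwb
  · have h2 := h.2.epir.t_le v i
    rcases M.deterministic v i with hx | hx <;> rw [hx] at h2 <;>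
      linarith [(h.1 i).1]
  set w' : Set.Icc (0 : ℝ) vbar := ⟨w, (h.1 i).1.trans hw.le, hwb⟩
  have hs : 0 < cornerScore r (Function.update v i w') i :=
    cornerScore_pos hi (by simpa [w'] using hw)
  have hx' : M.x (Function.update v i w') i = 1 := by
    refine h.2.wins _ i hs fun j hj => lt_of_le_of_lt ?_ hs
    refine cornerScore_nonpos (h.1 j).2 ?_
    rw [Function.update_of_ne hj]
    rcases hv j hj with h3 | h3
    · exact h3.le.trans (h.1 j).1
    · exact h3.le
  have hx : M.x v i = 1 := by
    have hs' : 0 < cornerScore r v i := cornerScore_pos hi (by linarith)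
    refine h.2.wins _ i hs' fun j hj => lt_of_le_of_lt ?_ hs'
    refine cornerScore_nonpos (h.1 j).2 ?_
    rcases hv j hj with h3 | h3
    · exact h3.le.trans (h.1 j).1
    · exact h3.le
  have h4 := h.2.dsic v i w'
  have h5 := h.2.epir.t_le (Function.update v i w') i
  rw [hx', hx] at h4
  rw [hx', Function.update_self] at h5
  have : (w' : ℝ) = w := rfl
  linarith

theorem le_of_forall_le_add_mul {A B R : ℝ} (h : ∀ e ∈ Set.Ioo (0 : ℝ) 1, A ≤ B + e * R) :
    A ≤ B := by
  have hc : Filter.Tendsto (fun e : ℝ => B + e * R) (nhdsWithin 0 (Set.Ioi 0)) (nhds B) := by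
    have : Continuous fun e : ℝ => B + e * R := by fun_prop
    simpa using (this.tendsto 0).mono_left nhdsWithin_le_nhds
  exact ge_of_tendsto hc (Filter.eventually_of_mem (Ioo_mem_nhdsGT one_pos) h)

/-- Any lower bound for the guarantee of a corner-hitting linear score auction is the value of a
dual feasible affine function. -/
theorem IsCornerHittingLSA.exists_isDualFeasible (h : IsCornerHittingLSA r M) (hb : 0 < vbar)
    {m : Fin n → ℝ} {g : ℝ} (hm : ∀ i, m i ∈ Set.Ioo 0 vbar) (hg : (g : EReal) ≤ M.guarantee m) :
    ∃ (lam : Fin n → ℝ) (c : ℝ), IsDualFeasible vbar (fun i => vbar - r i) lam c ∧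
      c - ∑ i, lam i * (vbar - m i) = g := by
  obtain ⟨lam, h0, hlam⟩ := M.exists_nonneg_affine_le hm (h.2.epir.sum_t_le hb.le) hg
  have hlam' : ∀ v : Profile n vbar, (∀ i, lam i = 0 → (v i : ℝ) = 0) →
      g + ∑ i, lam i * (vbar - m i) ≤ ∑ i, M.t v i + ∑ i, lam i * (vbar - v i) := by
    intro v hv
    have h1 := hlam v hv
    have h2 : ∑ i, lam i * ((v i : ℝ) - m i) =
        ∑ i, lam i * (vbar - m i) - ∑ i, lam i * (vbar - v i) := by
      rw [← Finset.sum_sub_distrib]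
      exact Finset.sum_congr rfl fun i _ => by ring
    linarith
  -- The values slightly below the reserve prices, and `0` where the coefficient vanishes.
  have hlow : ∀ e ∈ Set.Ioo (0 : ℝ) 1, ∀ i, (if lam i = 0 then 0 else (1 - e) * r i) ∈
      Set.Icc 0 vbar := by
    intro e he i
    split_ifs
    · exact ⟨le_rfl, hb.le⟩
    · exact ⟨mul_nonneg (by linarith [he.2]) (h.1 i).1,
        by nlinarith [he.1, (h.1 i).1, (h.1 i).2]⟩
  have hlow' : ∀ e ∈ Set.Ioo (0 : ℝ) 1, ∀ i, (if lam i = 0 then 0 else (1 - e) * r i) = 0 ∨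
      (if lam i = 0 then 0 else (1 - e) * r i) < r i := by
    intro e he i
    split_ifs
    · exact Or.inl rfl
    · rcases (h.1 i).1.eq_or_lt with h1 | h1
      · left; rw [← h1, mul_zero]
      · right; nlinarith [he.1]
  have hterm : ∀ e : ℝ, ∀ i, lam i * (vbar - (if lam i = 0 then 0 else (1 - e) * r i)) =
      lam i * (vbar - r i) + e * (lam i * r i) := by
    intro e i
    split_ifs with h1
    · simp [h1]
    · ring
  have hnone : g + ∑ i, lam i * (vbar - m i) ≤ ∑ j, lam j * (vbar - r j) := by
    refine le_of_forall_le_add_mul (R := ∑ i, lam i * r i) fun e he => ?_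
    have h1 := hlam' (fun i => ⟨_, hlow e he i⟩) fun i hi => by simp [hi]
    have h2 : ∑ i, M.t (fun i => ⟨_, hlow e he i⟩) i ≤ 0 :=
      Finset.sum_nonpos fun i _ => h.t_nonpos (hlow' e he i)
    simp only [hterm, Finset.sum_add_distrib, ← Finset.mul_sum] at h1
    linarith
  refine ⟨lam, g + ∑ i, lam i * (vbar - m i), ⟨h0, ?_, hnone, fun i => ?_⟩, by ring⟩
  · have h1 := hlam' (fun i => if lam i = 0 then ⟨0, le_rfl, hb.le⟩ else ⟨vbar, hb.le, le_rfl⟩)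
      fun i hi => by simp [hi]
    refine h1.trans ?_
    have h2 := h.2.epir.sum_t_le hb.le
      (fun i => if lam i = 0 then ⟨0, le_rfl, hb.le⟩ else ⟨vbar, hb.le, le_rfl⟩)
    refine (add_le_of_nonpos_right (Finset.sum_nonpos fun i _ => ?_)).trans h2
    split_ifs with h3 <;> simp [h3]
  · by_cases hri : r i = vbar
    · rw [hri]; linarith
    have hri : r i < vbar := lt_of_le_of_ne (h.1 i).2 hri
    by_cases hli : lam i = 0
    · rw [hli]; linarith [(h.1 i).1]
    suffices g + ∑ i, lam i * (vbar - m i) ≤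
        r i + ∑ j ∈ Finset.univ.erase i, lam j * (vbar - r j) by
      rw [← Finset.add_sum_erase _ (fun j => lam j * (vbar - r j)) (Finset.mem_univ i)]
      linarith
    refine le_of_forall_le_add_mul (R := ∑ j ∈ Finset.univ.erase i, lam j * r j) fun e he => ?_
    set u : Profile n vbar := Function.update (fun i => ⟨_, hlow e he i⟩) i ⟨vbar, hb.le, le_rfl⟩
      with hu
    have hui : (u i : ℝ) = vbar := by simp [hu]
    have huj : ∀ j, j ≠ i → (u j : ℝ) = if lam j = 0 then 0 else (1 - e) * r j := by
      intro j hj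
      simp [hu, Function.update_of_ne hj]
    have h1 := hlam' u fun j hj => by
      rw [huj j (by rintro rfl; exact hli hj), if_pos hj]
    have h2 : ∑ j, M.t u j ≤ r i :=
      h.sum_t_le_reserve hri hui fun j hj => by rw [huj j hj]; exact hlow' e he j
    have h3 : ∑ j, lam j * (vbar - u j) = ∑ j ∈ Finset.univ.erase i, lam j * (vbar - r j) +
        e * ∑ j ∈ Finset.univ.erase i, lam j * r j := by
      rw [← Finset.add_sum_erase _ _ (Finset.mem_univ i), hui, sub_self, mul_zero, zero_add,
        Finset.mul_sum, ← Finset.sum_add_distrib]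
      exact Finset.sum_congr rfl fun j hj => by
        rw [huj j (Finset.ne_of_mem_erase hj), hterm]
    linarith

end CornerHitting

end

/-! ### An auction attaining the dual value -/

section

variable {n : ℕ} {vbar : ℝ} {r : Fin n → ℝ} {v : Profile n vbar} {i : Fin n}

/-- The score that bidder `i` has to beat: the maximum of `0` and the scores of the others. -/
noncomputable def rivalScore (r : Fin n → ℝ) (v : Profile n vbar) (i : Fin n) : ℝ :=
  Finset.univ.sup' (Finset.univ_nonempty_iff.2 ⟨i⟩) fun j => if j = i then 0 else cornerScore r v j

theorem rivalScore_le_iff {z : ℝ} :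
    rivalScore r v i ≤ z ↔ 0 ≤ z ∧ ∀ j, j ≠ i → cornerScore r v j ≤ z := by
  rw [rivalScore, Finset.sup'_le_iff]
  constructor
  · exact fun h => ⟨by simpa using h i (Finset.mem_univ i),
      fun j hj => by simpa [hj] using h j (Finset.mem_univ j)⟩
  · rintro ⟨h0, h⟩ j -
    split_ifs with hj
    · exact h0
    · exact h j hj

theorem rivalScore_nonneg : 0 ≤ rivalScore r v i := (rivalScore_le_iff.1 le_rfl).1

theorem cornerScore_le_rivalScore {j : Fin n} (h : j ≠ i) :
    cornerScore r v j ≤ rivalScore r v i := (rivalScore_le_iff.1 le_rfl).2 j h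

theorem cornerScore_update_of_ne {j : Fin n} (h : j ≠ i) (w : Set.Icc (0 : ℝ) vbar) :
    cornerScore r (Function.update v i w) j = cornerScore r v j := by
  simp [cornerScore, score, Function.update_of_ne h]

theorem rivalScore_update (w : Set.Icc (0 : ℝ) vbar) :
    rivalScore r (Function.update v i w) i = rivalScore r v i := by
  unfold rivalScore
  congr 1
  funext j
  split_ifs with h
  · rfl
  · exact cornerScore_update_of_ne h w

/-- The value at which bidder `i` ties with the best of the others and the score `0`. -/
noncomputable def thresholdPrice (r : Fin n → ℝ) (v : Profile n vbar) (i : Fin n) : ℝ :=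
  r i + (vbar - r i) * rivalScore r v i

/-- Bidder `i` has the highest score, it is positive, and ties are broken in favour of the bidder
with the lowest number. -/
def Wins (r : Fin n → ℝ) (v : Profile n vbar) (i : Fin n) : Prop :=
  0 < cornerScore r v i ∧ ∀ j, cornerScore r v j < cornerScore r v i ∨
    (cornerScore r v j = cornerScore r v i ∧ i ≤ j)

theorem Wins.cornerScore_le (h : Wins r v i) (j : Fin n) :
    cornerScore r v j ≤ cornerScore r v i := by
  rcases h.2 j with h | h
  exacts [h.le, h.1.le]

theorem Wins.unique {j : Fin n} (hi : Wins r v i) (hj : Wins r v j) : i = j := by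
  rcases hi.2 j with h | h
  · exact absurd h (hj.cornerScore_le i).not_gt
  · rcases hj.2 i with h' | h'
    · exact absurd h' (hi.cornerScore_le j).not_gt
    · exact le_antisymm h.2 h'.2

theorem exists_wins (h : ∃ i, 0 < cornerScore r v i) : ∃ i, Wins r v i := by
  obtain ⟨k, hk⟩ := h
  obtain ⟨l, -, hl⟩ := Finset.exists_max_image Finset.univ (cornerScore r v) ⟨k, Finset.mem_univ k⟩
  obtain ⟨i, hi, hmin⟩ := Finset.exists_min_image
    (Finset.univ.filter fun i => cornerScore r v i = cornerScore r v l) id ⟨l, by simp⟩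
  have hi' : cornerScore r v i = cornerScore r v l := by simpa using hi
  refine ⟨i, by rw [hi']; exact hk.trans_le (hl k (Finset.mem_univ k)), fun j => ?_⟩
  rcases (hl j (Finset.mem_univ j)).lt_or_eq with h1 | h1
  · exact Or.inl (hi' ▸ h1)
  · exact Or.inr ⟨h1.trans hi'.symm, hmin j (by simp [h1])⟩

theorem Wins.lt (hr : r i ≤ vbar) (h : Wins r v i) : r i < vbar := by
  refine lt_of_le_of_ne hr fun h' => ?_
  have := h.1
  rw [cornerScore_of_eq h'] at this
  linarith [(v i).2.2]

theorem mul_cornerScore (h : r i < vbar) :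
    (vbar - r i) * cornerScore r v i = (v i : ℝ) - r i := by
  rw [cornerScore_of_lt h, mul_div_cancel₀ _ (by linarith)]

theorem mul_one_sub_cornerScore_le (hr : r i ≤ vbar) :
    (vbar - r i) * (1 - cornerScore r v i) ≤ vbar - v i := by
  rcases hr.lt_or_eq with h | h
  · rw [mul_sub, mul_cornerScore h]; linarith
  · rw [h]; linarith [(v i).2.2]

theorem Wins.thresholdPrice_le (hr : r i ≤ vbar) (h : Wins r v i) :
    thresholdPrice r v i ≤ v i := by
  have h1 := mul_cornerScore (v := v) (h.lt hr)
  have h2 : rivalScore r v i ≤ cornerScore r v i :=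
    rivalScore_le_iff.2 ⟨h.1.le, fun j _ => h.cornerScore_le j⟩
  rw [thresholdPrice]
  nlinarith

theorem le_thresholdPrice (hr : r i ≤ vbar) (h : ¬ Wins r v i) :
    (v i : ℝ) ≤ thresholdPrice r v i := by
  rcases hr.lt_or_eq with hi | hi
  · have h1 := mul_cornerScore (v := v) hi
    suffices cornerScore r v i ≤ rivalScore r v i by
      rw [thresholdPrice]
      nlinarith
    by_cases h0 : 0 < cornerScore r v i
    · have : ∃ j, j ≠ i ∧ cornerScore r v i ≤ cornerScore r v j := by
        by_contra! hc
        refine h ⟨h0, fun j => ?_⟩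
        by_cases hj : j = i
        · exact Or.inr ⟨by rw [hj], hj.ge⟩
        · exact Or.inl (hc j hj)
      obtain ⟨j, hj, hle⟩ := this
      exact hle.trans (cornerScore_le_rivalScore hj)
    · exact (not_lt.1 h0).trans rivalScore_nonneg
  · rw [thresholdPrice, hi, sub_self, zero_mul, add_zero]
    exact (v i).2.2

theorem thresholdPrice_update (w : Set.Icc (0 : ℝ) vbar) :
    thresholdPrice r (Function.update v i w) i = thresholdPrice r v i := by
  rw [thresholdPrice, rivalScore_update, thresholdPrice]

theorem thresholdPrice_nonneg (hr : r i ∈ Set.Icc 0 vbar) : 0 ≤ thresholdPrice r v i :=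
  add_nonneg hr.1 (mul_nonneg (by linarith [hr.2]) rivalScore_nonneg)

theorem measurable_cornerScore (r : Fin n → ℝ) (i : Fin n) :
    Measurable fun v : Profile n vbar => cornerScore r v i :=
  ((measurable_subtype_coe.comp (measurable_pi_apply i)).const_mul _).sub_const _

theorem measurable_thresholdPrice (r : Fin n → ℝ) (i : Fin n) :
    Measurable fun v : Profile n vbar => thresholdPrice r v i := by
  have h : Measurable fun v : Profile n vbar => rivalScore r v i := by
    have := Finset.measurable_sup' (s := Finset.univ) (Finset.univ_nonempty_iff.2 ⟨i⟩)
      (f := fun j (v : Profile n vbar) => if j = i then 0 else cornerScore r v j) fun j _ => by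
        by_cases hj : j = i
        · simp [hj]
        · simpa [hj] using measurable_cornerScore r j
    convert this using 1
    funext v
    rw [rivalScore, Finset.sup'_apply]
  exact (h.const_mul _).const_add _

theorem measurableSet_wins (r : Fin n → ℝ) (i : Fin n) :
    MeasurableSet {v : Profile n vbar | Wins r v i} := by
  have h := measurable_cornerScore (vbar := vbar) r
  have heq : {v : Profile n vbar | Wins r v i} = {v | 0 < cornerScore r v i} ∩
      ⋂ j, ({v | cornerScore r v j < cornerScore r v i} ∪
        ({v | cornerScore r v j = cornerScore r v i} ∩ {_v | i ≤ j})) := by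
    ext v
    simp [Wins]
  rw [heq]
  exact (measurableSet_lt measurable_const (h i)).inter (MeasurableSet.iInter fun j =>
    (measurableSet_lt (h j) (h i)).union
      ((measurableSet_eq_fun (h j) (h i)).inter (MeasurableSet.const _)))

open Classical in
/-- The corner-hitting linear score auction that breaks ties in favour of low numbers, does not sell
at the score `0`, and charges the threshold price. -/
noncomputable def scoreAuction (vbar : ℝ) (r : Fin n → ℝ) : Mechanism n vbar where
  x v i := if Wins r v i then 1 else 0
  t v i := if Wins r v i then thresholdPrice r v i else 0
  measurable_x i := Measurable.ite (measurableSet_wins r i) measurable_const measurable_const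
  measurable_t i :=
    Measurable.ite (measurableSet_wins r i) (measurable_thresholdPrice r i) measurable_const
  deterministic v i := by split_ifs <;> simp
  supply v := by
    rw [Finset.sum_boole]
    norm_cast
    refine Finset.card_le_one.2 fun i hi j hj => ?_
    simp only [Finset.mem_filter, Finset.mem_univ, true_and] at hi hj
    exact hi.unique hj

theorem isCornerHittingLSA_scoreAuction (hr : ∀ i, r i ∈ Set.Icc 0 vbar) :
    IsCornerHittingLSA r (scoreAuction vbar r) := by
  refine ⟨hr, fun i => ?_, fun i => ?_, fun v i w => ?_, fun v i => ?_, fun v i h0 h => ?_,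
    fun v i h => ?_⟩
  · have := (hr i).1
    unfold cornerAlpha
    split_ifs with h
    · exact div_nonneg this (by linarith)
    · exact this
  · unfold cornerBeta
    split_ifs with h
    · exact one_div_pos.2 (by linarith)
    · exact one_pos
  · simp only [scoreAuction]
    rw [thresholdPrice_update]
    by_cases h : Wins r v i
    · have := h.thresholdPrice_le (hr i).2
      rw [if_pos h, if_pos h]
      split_ifs <;> linarith
    · have := le_thresholdPrice (hr i).2 h
      rw [if_neg h, if_neg h]
      split_ifs <;> linarith
  · simp only [scoreAuction]
    split_ifs with h
    · have := h.thresholdPrice_le (hr i).2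
      linarith
    · simp
  · have : Wins r v i := ⟨h0, fun j => by
      by_cases hj : j = i
      · exact Or.inr ⟨by rw [hj], hj.ge⟩
      · exact Or.inl (h j hj)⟩
    simp [scoreAuction, this]
  · have : ¬ Wins r v i := by
      intro hw
      rcases h with h | ⟨j, -, h⟩
      · exact lt_asymm h hw.1
      · exact h.not_ge (hw.cornerScore_le j)
    simp [scoreAuction, this]

theorem scoreAuction_t_nonneg (hr : ∀ i, r i ∈ Set.Icc 0 vbar) (v : Profile n vbar) (i : Fin n) :
    0 ≤ (scoreAuction vbar r).t v i := by
  simp only [scoreAuction]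
  split_ifs
  exacts [thresholdPrice_nonneg (hr i), le_rfl]

/-- Dual feasibility is sufficient for the affine function to lie below the revenue. If `s` is the
larger of `0` and the second highest score, the bound at the winner's price is the convex
combination with weights `s` and `1 - s` of the bounds at the corner and at the point where only the
winner exceeds its reserve price. -/
theorem IsDualFeasible.le_scoreAuction_revenue {lam : Fin n → ℝ} {c : ℝ}
    (hr : ∀ i, r i ∈ Set.Icc 0 vbar) (h : IsDualFeasible vbar (fun i => vbar - r i) lam c)
    (v : Profile n vbar) :
    c - ∑ i, lam i * (vbar - v i) ≤ ∑ i, (scoreAuction vbar r).t v i := by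
  have ht := scoreAuction_t_nonneg hr v
  by_cases hw : ∃ i, 0 < cornerScore r v i
  · obtain ⟨i, hi⟩ := exists_wins hw
    have h1 : thresholdPrice r v i ≤ ∑ i, (scoreAuction vbar r).t v i := by
      refine le_trans (by simp [scoreAuction, hi]) (Finset.single_le_sum (fun j _ => ht j)
        (Finset.mem_univ i))
    refine le_trans ?_ h1
    set s := rivalScore r v i with hs
    have hs0 : 0 ≤ s := rivalScore_nonneg
    have hs1 : s ≤ 1 := by
      have hlt := hi.lt (hr i).2
      have h2 : s ≤ cornerScore r v i :=
        rivalScore_le_iff.2 ⟨hi.1.le, fun j _ => hi.cornerScore_le j⟩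
      refine h2.trans ?_
      rw [cornerScore_of_lt hlt, div_le_one (by linarith)]
      linarith [(v i).2.2]
    have h2 : (1 - s) * ∑ j ∈ Finset.univ.erase i, lam j * (vbar - r j) ≤
        ∑ j, lam j * (vbar - v j) := by
      rw [← Finset.add_sum_erase _ _ (Finset.mem_univ i), Finset.mul_sum]
      refine le_add_of_nonneg_of_le
        (mul_nonneg (h.nonneg i) (sub_nonneg.2 (v i).2.2)) (Finset.sum_le_sum fun j hj => ?_)
      have h3 := mul_one_sub_cornerScore_le (v := v) (hr j).2
      have h4 : cornerScore r v j ≤ s := cornerScore_le_rivalScore (Finset.ne_of_mem_erase hj)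
      have h5 : (1 - s) * (vbar - r j) ≤ vbar - v j := by nlinarith [(hr j).2]
      calc (1 - s) * (lam j * (vbar - r j)) = lam j * ((1 - s) * (vbar - r j)) := by ring
        _ ≤ _ := mul_le_mul_of_nonneg_left h5 (h.nonneg j)
    have h3 := h.le_single i
    rw [← Finset.add_sum_erase _ (fun j => lam j * (vbar - r j)) (Finset.mem_univ i)] at h3
    have h4 := h.le_corner
    have h5 : (1 - s) * c ≤ (1 - s) * (r i + ∑ j ∈ Finset.univ.erase i, lam j * (vbar - r j)) :=
      mul_le_mul_of_nonneg_left (by linarith) (by linarith)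
    have h6 : s * c ≤ s * vbar := mul_le_mul_of_nonneg_left h4 hs0
    rw [thresholdPrice, ← hs]
    linarith
  · push Not at hw
    refine le_trans ?_ (Finset.sum_nonneg fun i _ => ht i)
    have h1 : ∑ j, lam j * (vbar - r j) ≤ ∑ j, lam j * (vbar - v j) := by
      refine Finset.sum_le_sum fun j _ => mul_le_mul_of_nonneg_left ?_ (h.nonneg j)
      have h2 := mul_one_sub_cornerScore_le (v := v) (hr j).2
      nlinarith [hw j, (hr j).2]
    linarith [h.le_reserve]

theorem IsDualFeasible.le_guarantee (hb : 0 ≤ vbar) {lam m : Fin n → ℝ} {c : ℝ}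
    (hr : ∀ i, r i ∈ Set.Icc 0 vbar) (h : IsDualFeasible vbar (fun i => vbar - r i) lam c) :
    ((c - ∑ i, lam i * (vbar - m i) : ℝ) : EReal) ≤ (scoreAuction vbar r).guarantee m := by
  refine le_iInf₂ fun F hF => ?_
  have hprob := hF.1
  have hint : Integrable (fun v => ∑ i, (scoreAuction vbar r).t v i) F := by
    refine Integrable.of_bound (C := vbar)
      (scoreAuction vbar r).measurable_sum_t.aestronglyMeasurable
      (Filter.Eventually.of_forall fun v => ?_)
    rw [Real.norm_eq_abs, abs_of_nonneg (Finset.sum_nonneg fun i _ => scoreAuction_t_nonneg hr v i)]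
    exact (isCornerHittingLSA_scoreAuction hr).2.epir.sum_t_le hb v
  rw [Mechanism.revenue_eq_integral _ hint, EReal.coe_le_coe_iff]
  have hterm : ∀ i ∈ Finset.univ,
      Integrable (fun v : Profile n vbar => lam i * (vbar - (v i : ℝ))) F := fun i _ =>
    ((integrable_const _).sub (integrable_coord F i)).const_mul _
  have hsum := integrable_finsetSum _ hterm
  calc c - ∑ i, lam i * (vbar - m i)
      = ∫ v, (c - ∑ i, lam i * (vbar - (v i : ℝ))) ∂F := by
        rw [integral_sub (integrable_const _) hsum, integral_finsetSum _ hterm]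
        congr 1
        · simp
        · refine Finset.sum_congr rfl fun i _ => ?_
          rw [integral_const_mul, integral_sub (integrable_const _) (integrable_coord F i), hF.2 i]
          simp
    _ ≤ _ := integral_mono ((integrable_const _).sub hsum) hint (h.le_scoreAuction_revenue hr)

/-! ### Optimal prices and critical multipliers -/

section Optimality

variable {m lam : Fin n → ℝ} {η : ℝ}

/-- Given a solution `lam` of the optimality conditions, the optimal reserve prices are those for
which `lam` is dual feasible with the largest intercept compatible with its load. -/
theorem isOptimalPrices_iff (hb : 0 < vbar) (hm : ∀ i, m i ∈ Set.Ioo 0 vbar)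
    (hc : IsCritical vbar η (fun i => vbar - m i) lam) :
    IsOptimalPrices vbar m r ↔ (∀ i, r i ∈ Set.Icc 0 vbar) ∧
      IsDualFeasible vbar (fun i => vbar - r i) lam (vbar * load lam) := by
  have hμ : ∀ i, 0 < vbar - m i := fun i => sub_pos.2 (hm i).2
  constructor
  · rintro ⟨M, hM, hopt⟩
    -- The prices `vbar - vbar / (1 + lam i)` attain the upper bound, so `M` does as well.
    set r' : Fin n → ℝ := fun i => vbar - vbar / (1 + lam i)
    have hr' : ∀ i, r' i ∈ Set.Icc 0 vbar := fun i => by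
      have h1 := hc.nonneg i
      refine ⟨sub_nonneg.2 (div_le_self hb.le (by linarith)), sub_le_self _ (by positivity)⟩
    have hfeas : IsDualFeasible vbar (fun i => vbar - r' i) lam (vbar * load lam) := by
      simpa [r'] using isDualFeasible_div hb.le hc.nonneg hc.load_le
    obtain ⟨x, c, hx, hval⟩ := hM.exists_isDualFeasible hb hm
      ((hfeas.le_guarantee hb.le hr').trans (hopt r' _ (isCornerHittingLSA_scoreAuction hr')))
    obtain ⟨rfl, rfl⟩ := hx.eq_of_value_ge hb hμ hc hval.ge
    exact ⟨hM.1, hx⟩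
  · rintro ⟨hr, hfeas⟩
    refine ⟨scoreAuction vbar r, isCornerHittingLSA_scoreAuction hr, fun r' M' hM' => ?_⟩
    refine le_trans (EReal.ge_of_forall_gt_iff_ge.1 fun g hg => ?_) (hfeas.le_guarantee hb.le hr)
    obtain ⟨x, c, hx, hval⟩ := hM'.exists_isDualFeasible hb hm hg.le
    rw [← hval, EReal.coe_le_coe_iff]
    exact hx.value_le hb hμ hc

end Optimality

end

/-! ### Low and high means -/

section LowMeans

variable {n : ℕ} {vbar : ℝ} {m : Fin n → ℝ}

theorem sqrt_sub_pos (hm : ∀ i, m i ∈ Set.Ioo 0 vbar) (i : Fin n) : 0 < √(vbar - m i) :=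
  Real.sqrt_pos.2 (sub_pos.2 (hm i).2)

theorem sqrt_sub_lt (hm : ∀ i, m i ∈ Set.Ioo 0 vbar) (i : Fin n) :
    √(vbar - m i) < √vbar :=
  Real.sqrt_lt_sqrt (sub_nonneg.2 (hm i).2.le) (by linarith [(hm i).1])

theorem sum_sqrt_one_sub_div (hb : 0 < vbar) (m : Fin n → ℝ) :
    ∑ i, √(1 - m i / vbar) = (∑ i, √(vbar - m i)) / √vbar := by
  rw [Finset.sum_div]
  refine Finset.sum_congr rfl fun i _ => ?_
  rw [← Real.sqrt_div' _ hb.le, sub_div, div_self hb.ne']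

/-- If the sum of the roots is large, the unconstrained maximizer of
`∑ i, (vbar * lam i / (1 + lam i) - lam i * (vbar - m i))` has load below `1`. -/
theorem isOptimalPrices_iff_of_low_means (hb : 0 < vbar) (hm : ∀ i, m i ∈ Set.Ioo 0 vbar)
    (hlow : (n : ℝ) - 1 < ∑ i, √(1 - m i / vbar)) (r : Fin n → ℝ) :
    IsOptimalPrices vbar m r ↔ r = fun i => vbar - √(vbar * (vbar - m i)) := by
  have hq := sqrt_sub_pos hm
  have hqb := sqrt_sub_lt hm
  have hsb : 0 < √vbar := Real.sqrt_pos.2 hb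
  set lam : Fin n → ℝ := fun i => √vbar / √(vbar - m i) - 1 with hlamdef
  have hpos : ∀ i, 0 < lam i := fun i => by
    rw [hlamdef, sub_pos, one_lt_div (hq i)]
    exact hqb i
  have hone : ∀ i, 1 + lam i = √vbar / √(vbar - m i) := fun i => by simp [hlamdef]
  have hload : load lam < 1 := by
    have h1 : load lam = n - (∑ i, √(vbar - m i)) / √vbar := by
      have hn : (n : ℝ) = ∑ _i : Fin n, (1 : ℝ) := by simp
      rw [load, Finset.sum_div, hn, ← Finset.sum_sub_distrib]
      refine Finset.sum_congr rfl fun i _ => ?_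
      rw [hone, hlamdef]
      have := hq i
      field_simp
    rw [sum_sqrt_one_sub_div hb m] at hlow
    linarith
  have hsq : ∀ i, vbar = (1 + lam i) ^ 2 * (vbar - m i) := fun i => by
    have := sub_pos.2 (hm i).2
    rw [hone, div_pow, Real.sq_sqrt hb.le, Real.sq_sqrt this.le, div_mul_cancel₀ _ this.ne']
  have hc : IsCritical vbar vbar (fun i => vbar - m i) lam :=
    ⟨fun i => (hpos i).le, hb.le, le_rfl, fun i => (hsq i).le, fun i => Or.inr (hsq i), hload.le,
      by simp⟩
  have hprice : ∀ i, vbar / (1 + lam i) = √(vbar * (vbar - m i)) := fun i => by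
    rw [hone, Real.sqrt_mul hb.le, div_div_eq_mul_div, div_eq_iff hsb.ne', mul_right_comm,
      Real.mul_self_sqrt hb.le]
  rw [isOptimalPrices_iff hb hm hc]
  constructor
  · rintro ⟨-, hfeas⟩
    obtain ⟨h1, h2⟩ := hfeas.complementary hload.le rfl
    rw [mul_eq_zero, or_iff_right (by linarith)] at h1
    funext i
    have h3 := h2 i (hpos i)
    rw [add_sub_assoc, h1, add_zero, ← eq_div_iff (by linarith [hpos i]), hprice] at h3
    linarith
  · rintro rfl
    refine ⟨fun i => ?_, ?_⟩
    · dsimp only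
      rw [← hprice]
      exact ⟨sub_nonneg.2 (div_le_self hb.le (by linarith [hpos i])),
        sub_le_self _ (div_nonneg hb.le (by linarith [hpos i]))⟩
    · simpa [hprice] using isDualFeasible_div hb.le hc.nonneg hc.load_le

end LowMeans

section HighMeans

variable {n : ℕ} {vbar η : ℝ} {m lam r : Fin n → ℝ}

/-- If the critical multipliers have load `1`, optimality constrains the reserve prices of the
bidders with positive multipliers only: `vbar - r i` is proportional to `√(vbar - m i)`, with a
factor bounded from below. -/
theorem isOptimalPrices_iff_of_load_eq_one {θ : ℝ} (hb : 0 < vbar)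
    (hm : ∀ i, m i ∈ Set.Ioo 0 vbar) (hc : IsCritical vbar η (fun i => vbar - m i) lam)
    (hl : load lam = 1) (hlam : ∀ i, 0 < lam i → (1 + lam i) * √(vbar - m i) = θ)
    (hr : ∀ i, r i ∈ Set.Icc 0 vbar) {s : Finset (Fin n)} (hs : ∀ i, i ∈ s ↔ 0 < lam i) :
    IsOptimalPrices vbar m r ↔ ∑ i ∈ s, r i ≤ vbar ∧ (∀ i ∈ s, r i < vbar) ∧
      ∀ i ∈ s, ∀ j ∈ s, (vbar - r i) / (vbar - r j) = √((vbar - m i) / (vbar - m j)) := by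
  have hq := sqrt_sub_pos hm
  have hdiv : ∀ i j, √((vbar - m i) / (vbar - m j)) = √(vbar - m i) / √(vbar - m j) :=
    fun i j => Real.sqrt_div (sub_nonneg.2 (hm i).2.le) _
  have hload : ∑ i ∈ s, lam i / (1 + lam i) = 1 := by
    refine (Finset.sum_subset (Finset.subset_univ _) fun i _ hi => ?_).trans hl
    rw [hs] at hi
    rw [le_antisymm (not_lt.1 hi) (hc.nonneg i), zero_div]
  have hsum : ∀ K : ℝ, ∑ i ∈ s, K / (1 + lam i) = K * (s.card - 1) := by
    intro K
    have h1 : (s.card : ℝ) - 1 = ∑ i ∈ s, (1 - lam i / (1 + lam i)) := by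
      rw [Finset.sum_sub_distrib, hload]
      simp
    rw [h1, Finset.mul_sum]
    refine Finset.sum_congr rfl fun i _ => ?_
    have := hc.nonneg i
    field_simp
    ring
  have hne : s.Nonempty := by
    rw [Finset.nonempty_iff_ne_empty]
    rintro rfl
    simp at hload
  have hcard : (1 : ℝ) < s.card := by
    rw [← hload, ← nsmul_one s.card, ← Finset.sum_const]
    refine Finset.sum_lt_sum_of_nonempty hne fun i _ => ?_
    have := hc.nonneg i
    rw [div_lt_one (by linarith)]
    linarith
  rw [isOptimalPrices_iff hb hm hc, hl, mul_one]
  constructor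
  · rintro ⟨-, hfeas⟩
    have h1 := (hfeas.complementary hc.load_le (by rw [hl, mul_one])).2
    have hS := hfeas.le_reserve
    simp only [add_sub_cancel_left] at h1
    set S := ∑ j, lam j * (vbar - r j)
    have h2 : ∀ i ∈ s, vbar - r i = S / (1 + lam i) := fun i hi => by
      have := (hs i).1 hi
      rw [eq_div_iff (by linarith), h1 i this]
    refine ⟨?_, fun i hi => ?_, fun i hi j hj => ?_⟩
    · have h3 : ∑ i ∈ s, (vbar - r i) = S * (s.card - 1) := by
        rw [← hsum]
        exact Finset.sum_congr rfl h2
      rw [Finset.sum_sub_distrib, Finset.sum_const, nsmul_eq_mul] at h3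
      nlinarith
    · have := h2 i hi
      have : 0 < S / (1 + lam i) := div_pos (by linarith) (by linarith [(hs i).1 hi])
      linarith
    · have hi' := (hs i).1 hi
      have hj' := (hs j).1 hj
      have hSpos : S ≠ 0 := by linarith
      rw [hdiv, h2 i hi, h2 j hj, div_div_div_cancel_left' _ _ hSpos,
        div_eq_div_iff (by linarith) (hq j).ne']
      have e1 := hlam i hi'
      have e2 := hlam j hj'
      linarith
  · rintro ⟨h1, h2, h3⟩
    obtain ⟨k, hk⟩ := hne
    -- The common value of `(vbar - r i) * (1 + lam i)` over the bidders in `s`.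
    set K := (vbar - r k) * (1 + lam k) with hK
    have h4 : ∀ i ∈ s, (vbar - r i) * (1 + lam i) = K := fun i hi => by
      have e := h3 i hi k hk
      have e1 := hlam i ((hs i).1 hi)
      have e2 := hlam k ((hs k).1 hk)
      rw [hdiv, div_eq_div_iff (by linarith [h2 k hk]) (hq k).ne'] at e
      refine mul_right_cancel₀ (mul_pos (hq i) (hq k)).ne' ?_
      calc (vbar - r i) * (1 + lam i) * (√(vbar - m i) * √(vbar - m k))
          = ((vbar - r i) * √(vbar - m k)) * ((1 + lam i) * √(vbar - m i)) := by ring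
        _ = (√(vbar - m i) * (vbar - r k)) * ((1 + lam k) * √(vbar - m k)) := by rw [e, e1, e2]
        _ = K * (√(vbar - m i) * √(vbar - m k)) := by rw [hK]; ring
    have h5 : ∀ i ∈ s, vbar - r i = K / (1 + lam i) := fun i hi => by
      rw [eq_div_iff (by linarith [hc.nonneg i]), h4 i hi]
    have hKb : vbar ≤ K := by
      have h6 : ∑ i ∈ s, (vbar - r i) = K * (s.card - 1) := by
        rw [← hsum]
        exact Finset.sum_congr rfl h5
      rw [Finset.sum_sub_distrib, Finset.sum_const, nsmul_eq_mul] at h6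
      have : vbar * (s.card - 1) ≤ K * (s.card - 1) := by linarith
      exact le_of_mul_le_mul_right this (by linarith)
    have hS : ∑ j, lam j * (vbar - r j) = K := by
      have h7 : ∑ j ∈ s, lam j * (vbar - r j) = ∑ j, lam j * (vbar - r j) := by
        refine Finset.sum_subset (Finset.subset_univ _) fun i _ hi => ?_
        rw [hs] at hi
        rw [le_antisymm (not_lt.1 hi) (hc.nonneg i), zero_mul]
      rw [← h7, ← mul_one K, ← hload, Finset.mul_sum]
      refine Finset.sum_congr rfl fun i hi => ?_
      rw [h5 i hi]
      ring
    refine ⟨hr, hc.nonneg, le_rfl, by rw [hS]; exact hKb, fun i => ?_⟩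
    rw [hS, add_sub_cancel_left]
    by_cases hi : i ∈ s
    · exact (h4 i hi).le
    · rw [hs] at hi
      rw [le_antisymm (not_lt.1 hi) (hc.nonneg i)]
      linarith [(hr i).1]

theorem load_comp_equiv {ι : Type*} [Fintype ι] (lam : ι → ℝ) (e : Equiv.Perm ι) :
    load (lam ∘ e) = load lam :=
  Equiv.sum_comp e fun i => lam i / (1 + lam i)

theorem IsCritical.comp_equiv {ι : Type*} [Fintype ι] {b η : ℝ} {μ lam : ι → ℝ}
    (h : IsCritical b η μ lam) (e : Equiv.Perm ι) : IsCritical b η (μ ∘ e) (lam ∘ e) where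
  nonneg i := h.nonneg _
  eta_nonneg := h.eta_nonneg
  eta_le := h.eta_le
  le_sq i := h.le_sq _
  eq_or i := h.eq_or _
  load_le := (load_comp_equiv lam e).trans_le h.load_le
  slack := by rw [load_comp_equiv]; exact h.slack

/-- The set of which `kStar` is the minimum contains `n - 1`, so that `kStar` belongs to it. -/
theorem kStar_spec (hn : 2 ≤ n) (hm : ∀ i, m i ∈ Set.Ioo 0 vbar) :
    kStar vbar m + 1 ≤ n ∧ ∃ a : Fin n, (a : ℕ) + 1 = kStar vbar m ∧
      (n : ℝ) - kStar vbar m - 1 < ∑ i ∈ Finset.Ioi a, √(vbar - m i) / √(vbar - m a) := by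
  have hq := sqrt_sub_pos hm
  refine Nat.sInf_mem (s := {k : ℕ | k + 1 ≤ n ∧ ∃ a : Fin n, (a : ℕ) + 1 = k ∧
    (n : ℝ) - k - 1 < ∑ i ∈ Finset.Ioi a, √(vbar - m i) / √(vbar - m a)})
    ⟨n - 1, by omega, ⟨n - 2, by omega⟩, by simp only; omega, ?_⟩
  have h1 : (n : ℝ) - (n - 1 : ℕ) - 1 = 0 := by
    rw [Nat.cast_sub (by omega)]
    simp
  rw [h1]
  refine Finset.sum_pos (fun i _ => div_pos (hq i) (hq _)) ⟨⟨n - 1, by omega⟩, ?_⟩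
  rw [Finset.mem_Ioi, Fin.lt_def]
  simp only
  omega

theorem sum_Ioi_le_of_lt_kStar (hn : 2 ≤ n) (hm : ∀ i, m i ∈ Set.Ioo 0 vbar) {a : Fin n}
    (ha : (a : ℕ) + 1 < kStar vbar m) :
    ∑ i ∈ Finset.Ioi a, √(vbar - m i) ≤ ((n : ℝ) - ((a : ℕ) + 1 : ℕ) - 1) * √(vbar - m a) := by
  have h1 := Nat.notMem_of_lt_sInf ha
  have h2 := (kStar_spec hn hm).1
  rw [← div_le_iff₀ (sqrt_sub_pos hm a), Finset.sum_div]
  by_contra h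
  exact h1 ⟨by omega, a, rfl, not_le.1 h⟩

/-- The multipliers `lambdaHigh` satisfy the optimality conditions. The defining inequality of
`kStar` makes them positive from the position `kStar` on, its failure at the position before is the
optimality condition at the zero multipliers, and the assumption of high means bounds `η = θ ^ 2`
if there are no zero multipliers. -/
theorem isCritical_lambdaHigh (hn : 2 ≤ n) (hb : 0 < vbar) (hm : ∀ i, m i ∈ Set.Ioo 0 vbar)
    (hmono : Monotone m) (hhigh : ∑ i, √(1 - m i / vbar) ≤ (n : ℝ) - 1) :
    ∃ θ : ℝ, IsCritical vbar (θ ^ 2) (fun i => vbar - m i) (lambdaHigh vbar m) ∧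
      load (lambdaHigh vbar m) = 1 ∧
      ∀ i, 0 < lambdaHigh vbar m i → (1 + lambdaHigh vbar m i) * √(vbar - m i) = θ := by
  have hq := sqrt_sub_pos hm
  have hqb := sqrt_sub_lt hm
  have hanti : ∀ i j : Fin n, i ≤ j → √(vbar - m j) ≤ √(vbar - m i) := fun i j hij =>
    Real.sqrt_le_sqrt (by linarith [hmono hij])
  obtain ⟨hKn, a, ha, hKa⟩ := kStar_spec hn hm
  set K := kStar vbar m with hK
  have hT : Finset.univ.filter (fun j : Fin n => K ≤ (j : ℕ) + 1) = Finset.Ici a := by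
    ext j
    simp only [Finset.mem_filter, Finset.mem_univ, true_and, Finset.mem_Ici, Fin.le_def]
    omega
  have hnK : (0 : ℝ) < (n : ℝ) - K := by
    have : (K : ℝ) + 1 ≤ n := by exact_mod_cast hKn
    linarith
  set θ := (∑ j ∈ Finset.Ici a, √(vbar - m j)) / ((n : ℝ) - K) with hθdef
  have hθsum : ∑ j ∈ Finset.Ici a, √(vbar - m j) = θ * ((n : ℝ) - K) := by
    rw [hθdef, div_mul_cancel₀ _ hnK.ne']
  have hlam : ∀ i, lambdaHigh vbar m i = if a ≤ i then θ / √(vbar - m i) - 1 else 0 := by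
    intro i
    rw [lambdaHigh, ← hK, hT, ← hθdef]
    have : (i : ℕ) + 1 < K ↔ ¬ a ≤ i := by rw [Fin.le_def]; omega
    simp only [this, ite_not]
  have hθa : √(vbar - m a) < θ := by
    rw [← Finset.sum_div, lt_div_iff₀ (hq a)] at hKa
    have h1 : ∑ j ∈ Finset.Ici a, √(vbar - m j) =
        √(vbar - m a) + ∑ j ∈ Finset.Ioi a, √(vbar - m j) := by
      rw [← Finset.Ioi_insert, Finset.sum_insert (by simp)]
    rw [hθdef, lt_div_iff₀ hnK, h1]
    linarith
  have hθ : 0 < θ := (hq a).trans hθa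
  have hθlow : ∀ i, ¬ a ≤ i → θ ≤ √(vbar - m i) := by
    intro i hi
    rw [Fin.le_def] at hi
    -- It suffices to consider the position just before `kStar`.
    set p : Fin n := ⟨(a : ℕ) - 1, by omega⟩ with hp
    have hpv : (p : ℕ) = (a : ℕ) - 1 := rfl
    have h1 := sum_Ioi_le_of_lt_kStar hn hm (a := p) (by omega)
    have h2 : Finset.Ioi p = Finset.Ici a := by
      ext j
      simp only [Finset.mem_Ioi, Finset.mem_Ici, Fin.lt_def, Fin.le_def]
      omega
    have h3 : (((p : ℕ) + 1 : ℕ) : ℝ) + 1 = K := by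
      rw [← ha]
      push_cast
      rw [hpv, Nat.cast_sub (by omega)]
      simp
    rw [h2, hθsum, sub_sub, h3, mul_comm] at h1
    exact (le_of_mul_le_mul_left h1 hnK).trans (hanti i p (by rw [Fin.le_def]; omega))
  have hθb : θ ≤ √vbar := by
    by_cases h0 : ∃ i, ¬ a ≤ i
    · obtain ⟨i, hi⟩ := h0
      exact (hθlow i hi).trans (hqb i).le
    · push Not at h0
      have h1 : Finset.Ici a = Finset.univ := by
        ext j
        simp [h0 j]
      have h2 : (K : ℝ) = 1 := by
        have := h0 ⟨0, by omega⟩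
        rw [Fin.le_def] at this
        simp only at this
        rw [← ha]
        simp only [Nat.cast_add, Nat.cast_one, add_eq_right, Nat.cast_eq_zero]
        omega
      rw [sum_sqrt_one_sub_div hb m, div_le_iff₀ (Real.sqrt_pos.2 hb), ← h1, hθsum, h2,
        mul_comm] at hhigh
      exact le_of_mul_le_mul_left hhigh (h2 ▸ hnK)
  have hpos : ∀ i, a ≤ i → 0 < lambdaHigh vbar m i := fun i hi => by
    rw [hlam, if_pos hi, sub_pos, one_lt_div (hq i)]
    exact (hanti a i hi).trans_lt hθa
  have hzero : ∀ i, ¬ a ≤ i → lambdaHigh vbar m i = 0 := fun i hi => by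
    rw [hlam, if_neg hi]
  have hone : ∀ i, a ≤ i → 1 + lambdaHigh vbar m i = θ / √(vbar - m i) := fun i hi => by
    rw [hlam, if_pos hi, add_sub_cancel]
  have hsq : ∀ i, a ≤ i → θ ^ 2 = (1 + lambdaHigh vbar m i) ^ 2 * (vbar - m i) := fun i hi => by
    have := sub_pos.2 (hm i).2
    rw [hone i hi, div_pow θ, Real.sq_sqrt this.le, div_mul_cancel₀ _ this.ne']
  have hload : load (lambdaHigh vbar m) = 1 := by
    have h1 : load (lambdaHigh vbar m) = ∑ i ∈ Finset.Ici a, (1 - √(vbar - m i) / θ) := by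
      rw [load, ← Finset.sum_subset (Finset.subset_univ (Finset.Ici a)) fun i _ hi => by
        rw [hzero i (by simpa using hi), zero_div]]
      refine Finset.sum_congr rfl fun i hi => ?_
      have hi' := Finset.mem_Ici.1 hi
      have := hq i
      rw [hone i hi', eq_sub_of_add_eq' (hone i hi')]
      field_simp
    have h2 : ((n - (a : ℕ) : ℕ) : ℝ) = n - K + 1 := by
      rw [Nat.cast_sub a.2.le, ← ha]
      push_cast
      ring
    rw [h1, Finset.sum_sub_distrib, Finset.sum_const, nsmul_one, Fin.card_Ici, h2,
      ← Finset.sum_div, hθsum, mul_div_cancel_left₀ _ hθ.ne']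
    ring
  refine ⟨θ, ⟨fun i => ?_, sq_nonneg θ, ?_, fun i => ?_, fun i => ?_, hload.le, ?_⟩, hload,
    fun i hi => ?_⟩
  · by_cases hi : a ≤ i
    exacts [(hpos i hi).le, (hzero i hi).ge]
  · exact (pow_le_pow_left₀ hθ.le hθb 2).trans_eq (Real.sq_sqrt hb.le)
  · by_cases hi : a ≤ i
    · exact (hsq i hi).le
    · rw [hzero i hi, add_zero, one_pow, one_mul]
      exact (pow_le_pow_left₀ hθ.le (hθlow i hi) 2).trans_eq
        (Real.sq_sqrt (sub_nonneg.2 (hm i).2.le))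
  · by_cases hi : a ≤ i
    exacts [Or.inr (hsq i hi), Or.inl (hzero i hi)]
  · rw [hload, sub_self, mul_zero]
  · have hi' : a ≤ i := by
      by_contra h
      exact hi.ne' (hzero i h)
    rw [hone i hi', div_mul_cancel₀ _ (hq i).ne']

theorem isOptimalPrices_iff_of_high_means (hn : 2 ≤ n) (hb : 0 < vbar)
    (hm : ∀ i, m i ∈ Set.Ioo 0 vbar) (hhigh : ∑ i, √(1 - m i / vbar) ≤ (n : ℝ) - 1)
    (σ : Equiv.Perm (Fin n)) (hσ : Monotone (m ∘ σ)) (hr : ∀ i, r i ∈ Set.Icc 0 vbar) :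
    IsOptimalPrices vbar m r ↔ ∑ i ∈ strictlyIncluded vbar m σ, r i ≤ vbar ∧
      (∀ i ∈ strictlyIncluded vbar m σ, r i < vbar) ∧
      ∀ i ∈ strictlyIncluded vbar m σ, ∀ j ∈ strictlyIncluded vbar m σ,
        (vbar - r i) / (vbar - r j) = √((vbar - m i) / (vbar - m j)) := by
  have hhigh' : ∑ i, √(1 - (m ∘ σ) i / vbar) ≤ (n : ℝ) - 1 :=
    (Equiv.sum_comp σ fun i => √(1 - m i / vbar)).trans_le hhigh
  obtain ⟨θ, hc, hl, hlam⟩ := isCritical_lambdaHigh (m := m ∘ σ) hn hb (fun i => hm (σ i)) hσ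
    hhigh'
  have hc' := hc.comp_equiv σ.symm
  have hμ : (fun i => vbar - (m ∘ σ) i) ∘ σ.symm = fun i => vbar - m i := by
    funext i
    simp
  rw [hμ] at hc'
  refine isOptimalPrices_iff_of_load_eq_one (θ := θ) hb hm hc'
    ((load_comp_equiv _ _).trans hl)
    (fun i hi => ?_) hr fun i => by simp [strictlyIncluded]
  simpa using hlam (σ.symm i) hi

end HighMeans

end RobustAuction

theorem mainTheorem3 (n : ℕ) (hn : 2 ≤ n) (vbar : ℝ) (hvbar : 0 < vbar)
    (m : Fin n → ℝ) (hm : ∀ i, m i ∈ Set.Ioo 0 vbar) :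
    ((n : ℝ) - 1 < ∑ i, √(1 - m i / vbar) →
      ∀ r : Fin n → ℝ, RobustAuction.IsOptimalPrices vbar m r ↔
        r = fun i => vbar - √(vbar * (vbar - m i))) ∧
    (∑ i, √(1 - m i / vbar) ≤ (n : ℝ) - 1 →
      ∀ σ : Equiv.Perm (Fin n), Monotone (m ∘ σ) →
      ∀ r : Fin n → ℝ, (∀ i, r i ∈ Set.Icc 0 vbar) →
        (RobustAuction.IsOptimalPrices vbar m r ↔
          ∑ i ∈ RobustAuction.strictlyIncluded vbar m σ, r i ≤ vbar ∧
          (∀ i ∈ RobustAuction.strictlyIncluded vbar m σ, r i < vbar) ∧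
          ∀ i ∈ RobustAuction.strictlyIncluded vbar m σ,
            ∀ j ∈ RobustAuction.strictlyIncluded vbar m σ,
              (vbar - r i) / (vbar - r j) = √((vbar - m i) / (vbar - m j)))) := by
  exact ⟨RobustAuction.isOptimalPrices_iff_of_low_means hvbar hm, fun hhigh σ hσ r hr =>
    RobustAuction.isOptimalPrices_iff_of_high_means hn hvbar hm hhigh σ hσ hr⟩
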